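/- Let $\mathcal{P}_2=\{(x,x^2): x\in\mathbb{R}\}\subset\mathbb{R}^2$ be the standard parabola and, for $E\subset\mathbb{R}^2$, let $\Pi(E)=\{u\cdot v: u,v\in E\}\subset\mathbb{R}$ be its dot product set. Write $\dim_H$ for Hausdorff dimension and $|\cdot|$ for Lebesgue measure on $\mathbb{R}$. For all $x,y\in\mathbb{R}$ one has $(x,x^2)\cdot(y,y^2)=\left(xy+\tfrac12\right)^2-\tfrac14$. Moreover, there exists a compact set $F\subset\mathbb{R}$ with $\dim_H F=1$ and $|\{xy: x,y\in F\}|=0$ such that the set $E=\{(x,x^2): x\in F\}$ is a compact subset of $\mathcal{P}_2$ with $\dim_H E=1$ and $|\Pi(E)|=0$. In particular, there exists a compact subset $E$ of $\mathcal{P}_2$ with $\dim_H E=1$ and $|\Pi(E)|=0$. -/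

import Mathlib

open MeasureTheory

/-- The point `(x, x²)` of the Euclidean plane. -/
noncomputable def parabolaPoint (x : ℝ) : EuclideanSpace ℝ (Fin 2) :=
  !₂[x, x ^ 2]

/-- The standard parabola `{(x, x²) : x ∈ ℝ}` in the Euclidean plane. -/
def standardParabola : Set (EuclideanSpace ℝ (Fin 2)) :=
  Set.range parabolaPoint

/-- The dot product set `{x · y : x, y ∈ E}` of a set `E` in Euclidean `d`-space. -/
def dotProductSet {d : ℕ} (E : Set (EuclideanSpace ℝ (Fin d))) : Set ℝ :=
  {t : ℝ | ∃ x ∈ E, ∃ y ∈ E, t = inner ℝ x y}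

/-!
The identity for dot products on the parabola shows that the dot product set of `{(x, x²) : x ∈ F}`
is a smooth image of `F * F`, and `F = exp G` turns products into sums, so it suffices to find a
compact `G ⊆ ℝ` of dimension one with `G + G` null.

If all digits of `x` and `y` in base `b` are smaller than `b / 4`, then all fractional parts of
`b ^ n * x` and `b ^ n * y` are at most `1 / 4`, so those of `b ^ n * (x + y)` are at most `1 / 2`.
Multiplication by `b` is ergodic on the circle, hence such sums form a null set. On the other hand,
rereading the digits of the admissible `x` in base `b / 4` maps them onto `[0, 1]` and is Hölder of
exponent `log (b / 4) / log b`, which tends to one as `b` grows and bounds their dimension from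
below.

Let `b` run through a sequence in which each base is a power of the previous one, so that a
condition for one base implies those for all later bases, and take the union over `b` of the
admissible `x` in `[0, 1 / b]`; since these pieces shrink to `0`, the union is compact.
-/

open Set Filter Topology
open scoped Pointwise ENNReal NNReal

section Topology

lemma isCompact_insert_iUnion_of_tendsto_smallSets {ι X : Type*} [TopologicalSpace X] {a : X}
    {K : ι → Set X} (hK : ∀ i, IsCompact (K i)) (ha : Tendsto K cofinite (𝓝 a).smallSets) :
    IsCompact (insert a (⋃ i, K i)) := by
  rw [isCompact_iff_ultrafilter_le_nhds]
  intro f hf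
  by_cases hfa : (f : Filter X) ≤ 𝓝 a
  · exact ⟨a, mem_insert _ _, hfa⟩
  obtain ⟨U, hU, hUf⟩ : ∃ U ∈ 𝓝 a, U ∉ f := by simpa [Filter.le_def] using hfa
  have hfin : {i | ¬K i ⊆ U}.Finite := tendsto_smallSets_iff.1 ha U hU
  have hmem : (⋃ i ∈ {i | ¬K i ⊆ U}, K i) ∈ f := by
    filter_upwards [le_principal_iff.1 hf, Ultrafilter.compl_mem_iff_notMem.2 hUf] with x hx hxU
    rcases hx with rfl | hx
    · exact absurd (mem_of_mem_nhds hU) hxU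
    obtain ⟨i, hi⟩ := mem_iUnion.1 hx
    exact mem_biUnion (fun hiU => hxU (hiU hi)) hi
  obtain ⟨x, hx, hfx⟩ := isCompact_iff_ultrafilter_le_nhds.1
    (hfin.isCompact_biUnion fun i _ => hK i) f (le_principal_iff.2 hmem)
  exact ⟨x, mem_insert_of_mem _ (iUnion₂_subset_iUnion _ _ hx), hfx⟩

end Topology

section Dimension

lemma dimH_range_le_of_edist_le {ι X Y : Type*} [EMetricSpace X] [EMetricSpace Y] {f : ι → X}
    {g : ι → Y} {C r : ℝ≥0} (hr : 0 < r)
    (h : ∀ i j, edist (g i) (g j) ≤ C * edist (f i) (f j) ^ (r : ℝ)) :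
    dimH (range g) ≤ dimH (range f) / r := by
  rcases isEmpty_or_nonempty ι with _ | ⟨⟨i₀⟩⟩
  · simp [range_eq_empty g]
  have hfactors : g.FactorsThrough f := fun i j hij => by
    simpa [hij, hr] using h i j
  have hextend : ∀ i, Function.extend f g (fun _ => g i₀) (f i) = g i := hfactors.extend_apply _
  have hholder : HolderOnWith C r (Function.extend f g fun _ => g i₀) (range f) := by
    rintro _ ⟨i, rfl⟩ _ ⟨j, rfl⟩
    simpa only [hextend] using h i j
  have himage : Function.extend f g (fun _ => g i₀) '' range f = range g := by
    simp only [← range_comp, Function.comp_def, hextend]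
  exact himage ▸ hholder.dimH_image_le hr

lemma dimH_exp_image (s : Set ℝ) : dimH (Real.exp '' s) = dimH s := by
  refine le_antisymm
    (Real.contDiff_exp.contDiffOn.dimH_image_le convex_univ (subset_univ s)) ?_
  have hlog : ContDiffOn ℝ 1 Real.log (Ioi 0) :=
    Real.contDiffOn_log.mono fun x hx => (mem_Ioi.1 hx).ne'
  have hpos : Real.exp '' s ⊆ Ioi 0 := image_subset_iff.2 fun x _ => Real.exp_pos x
  simpa only [image_image, Real.log_exp, image_id'] using hlog.dimH_image_le (convex_Ioi 0) hpos

end Dimension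

section Survivors

variable {M : Type*}

/-- The points of `M` whose orbit under multiplication by `b` never leaves `s`. On the circle, these
are the points all of whose base-`b` shifts lie in `s`. -/
def survivorSet [AddMonoid M] (b : ℕ) (s : Set M) : Set M :=
  {x | ∀ n : ℕ, b ^ n • x ∈ s}

lemma survivorSet_subset_survivorSet_pow [AddMonoid M] (b k : ℕ) (s : Set M) :
    survivorSet b s ⊆ survivorSet (b ^ k) s := fun x hx n => by
  simpa only [← pow_mul] using hx (k * n)

lemma survivorSet_subset [AddMonoid M] (b : ℕ) (s : Set M) : survivorSet b s ⊆ s :=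
  fun x hx => by simpa using hx 0

lemma survivorSet_mono [AddMonoid M] (b : ℕ) {s t : Set M} (h : s ⊆ t) :
    survivorSet b s ⊆ survivorSet b t := fun _ hx n => h (hx n)

lemma mapsTo_nsmul_survivorSet [AddMonoid M] (b : ℕ) (s : Set M) :
    MapsTo (b • ·) (survivorSet b s) (survivorSet b s) := fun x hx n => by
  simpa only [smul_smul, ← pow_succ] using hx (n + 1)

lemma survivorSet_add_subset [AddCommMonoid M] (b : ℕ) (s t : Set M) :
    survivorSet b s + survivorSet b t ⊆ survivorSet b (s + t) := by
  rintro _ ⟨x, hx, y, hy, rfl⟩ n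
  simpa only [smul_add] using add_mem_add (hx n) (hy n)

lemma isClosed_survivorSet [AddMonoid M] [TopologicalSpace M] [ContinuousAdd M] (b : ℕ)
    {s : Set M} (hs : IsClosed s) : IsClosed (survivorSet b s) := by
  have hinter : survivorSet b s = ⋂ n : ℕ, (b ^ n • ·) ⁻¹' s := by
    ext x
    simp [survivorSet]
  exact hinter ▸ isClosed_iInter fun n => hs.preimage (continuous_nsmul (b ^ n))

lemma measure_eq_zero_of_isClosed_of_mapsTo {X : Type*} [TopologicalSpace X] [MeasurableSpace X]
    [OpensMeasurableSpace X] {μ : Measure X} [IsFiniteMeasure μ] [μ.IsOpenPosMeasure] {f : X → X}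
    (hf : Ergodic f μ) {s : Set X} (hs : IsClosed s) (hfs : MapsTo f s s) (hne : s ≠ univ) :
    μ s = 0 := by
  have hdichotomy := hf.ae_empty_or_univ_of_ae_le_preimage hs.measurableSet.nullMeasurableSet
    (LE.le.eventuallyLE hfs)
  exact ae_eq_empty.1 (hdichotomy.resolve_right fun h => hne (hs.ae_eq_univ_iff_eq.1 h))

lemma volume_survivorSet_eq_zero {T : ℝ} [Fact (0 < T)] {b : ℕ} (hb : 1 < b)
    {s : Set (AddCircle T)} (hs : IsClosed s) (hne : s ≠ univ) :
    volume (survivorSet b s) = 0 :=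
  measure_eq_zero_of_isClosed_of_mapsTo (AddCircle.ergodic_nsmul hb) (isClosed_survivorSet b hs)
    (mapsTo_nsmul_survivorSet b s) fun h => hne (univ_subset_iff.1 (h ▸ survivorSet_subset b s))

lemma volume_preimage_coe_addCircle_eq_zero {T : ℝ} [Fact (0 < T)] {s : Set (AddCircle T)}
    (hs : volume s = 0) : volume ((↑) ⁻¹' s : Set ℝ) = 0 := by
  have hperiod (n : ℤ) : volume ((↑) ⁻¹' s ∩ Ioc (n • T) ((n + 1) • T)) = 0 := by
    rw [add_smul, one_smul, ← Measure.restrict_apply₀' nullMeasurableSet_Ioc]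
    exact (AddCircle.measurePreserving_mk T _).quasiMeasurePreserving.preimage_null hs
  rw [← inter_univ (_ ⁻¹' s), ← iUnion_Ioc_zsmul (Fact.out : 0 < T), inter_iUnion]
  exact measure_iUnion_null hperiod

/-- The image in `ℝ / ℤ` of the interval `[0, c]`. -/
def initialArc (c : ℝ) : Set UnitAddCircle :=
  (↑) '' Icc (0 : ℝ) c

lemma isClosed_initialArc (c : ℝ) : IsClosed (initialArc c) :=
  (isCompact_Icc.image (AddCircle.continuous_mk' 1)).isClosed

lemma initialArc_add_subset (c d : ℝ) : initialArc c + initialArc d ⊆ initialArc (c + d) := by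
  rintro _ ⟨_, ⟨x, hx, rfl⟩, _, ⟨y, hy, rfl⟩, rfl⟩
  exact ⟨x + y, ⟨add_nonneg hx.1 hy.1, add_le_add hx.2 hy.2⟩, AddCircle.coe_add 1 x y⟩

lemma initialArc_ne_univ {c : ℝ} (hc : c < 1) : initialArc c ≠ univ := by
  obtain ⟨z, hz, hz1⟩ := exists_between (max_lt hc one_pos)
  rw [max_lt_iff] at hz
  refine (ne_univ_iff_exists_notMem _).2 ⟨(z : UnitAddCircle), ?_⟩
  rintro ⟨x, hx, hxz⟩
  have : x = z := (AddCircle.coe_eq_coe_iff_of_mem_Ico (p := (1 : ℝ)) (a := 0)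
    ⟨hx.1, by linarith [hx.2]⟩ ⟨hz.2.le, by linarith⟩).1 hxz
  linarith [hx.2]

/-- The points of `[0, 1 / b]` all of whose products with powers of `b` have fractional part at most
`c`, for `c < 1`. -/
def survivorPiece (b : ℕ) (c : ℝ) : Set ℝ :=
  Icc 0 (b : ℝ)⁻¹ ∩ (↑) ⁻¹' survivorSet b (initialArc c)

lemma isCompact_survivorPiece (b : ℕ) (c : ℝ) : IsCompact (survivorPiece b c) :=
  isCompact_Icc.inter_right
    ((isClosed_survivorSet b (isClosed_initialArc c)).preimage (AddCircle.continuous_mk' 1))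

lemma zero_mem_survivorPiece (b : ℕ) {c : ℝ} (hc : 0 ≤ c) : 0 ∈ survivorPiece b c :=
  ⟨⟨le_rfl, by positivity⟩, fun n => ⟨0, ⟨le_rfl, hc⟩, by simp⟩⟩

lemma inv_mul_mem_survivorPiece {b : ℕ} (hb : 0 < b) {c x : ℝ} (hx : x ∈ Icc 0 c) (hx1 : x ≤ 1)
    (hxs : (x : UnitAddCircle) ∈ survivorSet b (initialArc c)) :
    (b : ℝ)⁻¹ * x ∈ survivorPiece b c := by
  have hx0 : 0 ≤ (b : ℝ)⁻¹ * x := mul_nonneg (by positivity) hx.1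
  have hxc : (b : ℝ)⁻¹ * x ≤ c :=
    (mul_le_of_le_one_left hx.1 (Nat.cast_inv_le_one b)).trans hx.2
  refine ⟨⟨hx0, mul_le_of_le_one_right (by positivity) hx1⟩, ?_⟩
  rintro (_ | n)
  · exact ⟨(b : ℝ)⁻¹ * x, ⟨hx0, hxc⟩, by simp⟩
  · have hshift : b ^ (n + 1) • ((b : ℝ)⁻¹ * x) = b ^ n • x := by
      simp only [nsmul_eq_mul, Nat.cast_pow]
      field_simp
      ring
    rw [← AddCircle.coe_nsmul, hshift, AddCircle.coe_nsmul]
    exact hxs n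

end Survivors

section Digits

lemma ofDigits_eq_inv_mul_add {b : ℕ} (u : ℕ → Fin b) :
    Real.ofDigits u = (b : ℝ)⁻¹ * (u 0 + Real.ofDigits fun i => u (i + 1)) := by
  rw [Real.ofDigits_eq_sum_add_ofDigits u 1]
  simp only [Finset.sum_range_one, Real.ofDigitsTerm, zero_add, pow_one]
  ring

lemma ofDigits_sub_ofDigits_of_forall_lt {b n : ℕ} {u v : ℕ → Fin b} (h : ∀ i < n, u i = v i) :
    Real.ofDigits u - Real.ofDigits v = ((b : ℝ) ^ n)⁻¹ *
      (Real.ofDigits (fun i => u (i + n)) - Real.ofDigits fun i => v (i + n)) := by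
  have hsum : ∑ i ∈ Finset.range n, Real.ofDigitsTerm u i =
      ∑ i ∈ Finset.range n, Real.ofDigitsTerm v i :=
    Finset.sum_congr rfl fun i hi => by
      simp only [Real.ofDigitsTerm, h i (Finset.mem_range.1 hi)]
  rw [Real.ofDigits_eq_sum_add_ofDigits u n, Real.ofDigits_eq_sum_add_ofDigits v n, hsum]
  ring

lemma pow_nsmul_coe_ofDigits {b : ℕ} (u : ℕ → Fin b) (n : ℕ) :
    b ^ n • (Real.ofDigits u : UnitAddCircle) = (Real.ofDigits fun i => u (i + n) : ℝ) := by
  have hb : (b : ℝ) ≠ 0 := Nat.cast_ne_zero.2 (Fin.pos (u 0)).ne'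
  induction n with
  | zero => simp
  | succ n ih =>
    have hshift : b • Real.ofDigits (fun i => u (i + n)) =
        (u n : ℕ) + Real.ofDigits fun i => u (i + (n + 1)) := by
      rw [ofDigits_eq_inv_mul_add, nsmul_eq_mul, mul_inv_cancel_left₀ hb]
      simp only [zero_add, add_assoc, add_comm 1 n]
    have hdigit : (((u n : ℕ) : ℝ) : UnitAddCircle) = 0 :=
      (AddCircle.coe_eq_zero_iff 1).2 ⟨(u n : ℕ), by simp⟩
    rw [pow_succ', mul_smul, ih, ← AddCircle.coe_nsmul, hshift, AddCircle.coe_add, hdigit, zero_add]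

lemma inv_pow_eq_inv_pow_rpow_logb {b D : ℕ} (hD : 0 < D) (hb : 1 < b) (n : ℕ) :
    ((D : ℝ) ^ n)⁻¹ = (((b : ℝ) ^ n)⁻¹) ^ Real.logb b D := by
  have hb0 : (0 : ℝ) < b := Nat.cast_pos.2 (zero_lt_one.trans hb)
  rw [Real.inv_rpow (by positivity), ← Real.rpow_natCast_mul hb0.le, mul_comm,
    Real.rpow_mul_natCast hb0.le, Real.rpow_logb hb0 (by exact_mod_cast hb.ne') (by positivity)]

variable {b D : ℕ} (h : D ≤ b)

/-- The number with base-`b` digits `a 0, a 1, …` after the radix point, all smaller than `D`. -/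
noncomputable def ofSmallDigits (a : ℕ → Fin D) : ℝ :=
  Real.ofDigits fun i => Fin.castLE h (a i)

lemma ofSmallDigits_mem_Icc (a : ℕ → Fin D) : ofSmallDigits h a ∈ Icc 0 (D / b : ℝ) := by
  refine ⟨Real.ofDigits_nonneg _, ?_⟩
  have hhead : ((a 0 : ℕ) : ℝ) + 1 ≤ D := by exact_mod_cast (a 0).isLt
  have htail := Real.ofDigits_le_one fun i => Fin.castLE h (a (i + 1))
  rw [ofSmallDigits, ofDigits_eq_inv_mul_add, div_eq_inv_mul, Fin.val_castLE]
  gcongr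
  linarith

lemma coe_ofSmallDigits_mem_survivorSet (a : ℕ → Fin D) :
    (ofSmallDigits h a : UnitAddCircle) ∈ survivorSet b (initialArc (D / b)) := fun n => by
  rw [ofSmallDigits, pow_nsmul_coe_ofDigits]
  exact mem_image_of_mem _ (ofSmallDigits_mem_Icc h fun i => a (i + n))

lemma le_abs_ofSmallDigits_sub_of_zero_ne {a a' : ℕ → Fin D} (h0 : a 0 ≠ a' 0) :
    (b : ℝ)⁻¹ * (1 - D / b) ≤ |ofSmallDigits h a - ofSmallDigits h a'| := by
  have htail := ofSmallDigits_mem_Icc h fun i => a (i + 1)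
  have htail' := ofSmallDigits_mem_Icc h fun i => a' (i + 1)
  have hhead : (1 : ℝ) ≤ |((a 0 : ℕ) : ℝ) - (a' 0 : ℕ)| := by
    have : ((a 0 : ℕ) : ℤ) - (a' 0 : ℕ) ≠ 0 := by omega
    exact_mod_cast Int.one_le_abs this
  have hdiff : ofSmallDigits h a - ofSmallDigits h a' = (b : ℝ)⁻¹ * (((a 0 : ℕ) - (a' 0 : ℕ)) -
      (ofSmallDigits h (fun i => a' (i + 1)) - ofSmallDigits h fun i => a (i + 1))) := by
    simp only [ofSmallDigits]
    rw [ofDigits_eq_inv_mul_add fun i => Fin.castLE h (a i),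
      ofDigits_eq_inv_mul_add fun i => Fin.castLE h (a' i)]
    simp only [Fin.val_castLE]
    ring
  rw [hdiff, abs_mul, abs_of_nonneg (by positivity : (0 : ℝ) ≤ (b : ℝ)⁻¹)]
  gcongr
  calc (1 : ℝ) - D / b ≤ |((a 0 : ℕ) : ℝ) - (a' 0 : ℕ)| -
        |ofSmallDigits h (fun i => a' (i + 1)) - ofSmallDigits h fun i => a (i + 1)| :=
        sub_le_sub hhead (by simpa using abs_sub_le_of_le_of_le htail'.1 htail'.2 htail.1 htail.2)
    _ ≤ _ := abs_sub_abs_le_abs_sub _ _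

lemma le_abs_ofSmallDigits_sub {n : ℕ} {a a' : ℕ → Fin D} (hlt : ∀ i < n, a i = a' i)
    (hn : a n ≠ a' n) :
    ((b : ℝ) ^ n)⁻¹ * ((b : ℝ)⁻¹ * (1 - D / b)) ≤ |ofSmallDigits h a - ofSmallDigits h a'| := by
  rw [ofSmallDigits, ofSmallDigits, ofDigits_sub_ofDigits_of_forall_lt fun i hi => by rw [hlt i hi],
    abs_mul, abs_of_nonneg (by positivity)]
  gcongr
  exact le_abs_ofSmallDigits_sub_of_zero_ne h (a := fun i => a (i + n)) (a' := fun i => a' (i + n))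
    (by simpa using hn)

lemma dist_ofDigits_le_mul_dist_ofSmallDigits_rpow (hD : 0 < D) (hDb : D < b) (a a' : ℕ → Fin D) :
    dist (Real.ofDigits a) (Real.ofDigits a') ≤
      ((b : ℝ)⁻¹ * (1 - D / b))⁻¹ ^ Real.logb b D *
        dist (ofSmallDigits hDb.le a) (ofSmallDigits hDb.le a') ^ Real.logb b D := by
  have hb0 : (0 : ℝ) < b := Nat.cast_pos.2 (hD.trans hDb)
  have hc : 0 < (b : ℝ)⁻¹ * (1 - D / b) :=
    mul_pos (inv_pos.2 hb0) (sub_pos.2 ((div_lt_one hb0).2 (Nat.cast_lt.2 hDb)))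
  have hr : 0 ≤ Real.logb b D :=
    Real.logb_nonneg (Nat.one_lt_cast.2 (by omega)) (Nat.one_le_cast.2 hD)
  rcases eq_or_ne a a' with rfl | hne
  · rw [dist_self]
    positivity
  obtain ⟨n, hn, hlt⟩ : ∃ n, a n ≠ a' n ∧ ∀ i < n, a i = a' i := by
    have hex := Function.ne_iff.1 hne
    classical
    exact ⟨Nat.find hex, Nat.find_spec hex, fun i hi => not_not.1 (Nat.find_min hex hi)⟩
  rw [← Real.mul_rpow (by positivity) dist_nonneg]
  calc dist (Real.ofDigits a) (Real.ofDigits a') ≤ ((D : ℝ) ^ n)⁻¹ :=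
        Real.abs_ofDigits_sub_ofDigits_le hlt
    _ = (((b : ℝ) ^ n)⁻¹) ^ Real.logb b D := inv_pow_eq_inv_pow_rpow_logb hD (by omega) n
    _ ≤ _ := by
        gcongr
        rw [le_inv_mul_iff₀ hc, mul_comm]
        exact le_abs_ofSmallDigits_sub hDb.le hlt hn

lemma ofReal_logb_le_dimH_range_ofSmallDigits (hD : 1 < D) (hDb : D < b) :
    ENNReal.ofReal (Real.logb b D) ≤ dimH (range (ofSmallDigits hDb.le)) := by
  have hr : 0 < Real.logb b D :=
    Real.logb_pos (Nat.one_lt_cast.2 (hD.trans hDb)) (Nat.one_lt_cast.2 hD)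
  have hholder (a a' : ℕ → Fin D) : edist (Real.ofDigits a) (Real.ofDigits a') ≤
      (((b : ℝ)⁻¹ * (1 - D / b))⁻¹ ^ Real.logb b D).toNNReal *
        edist (ofSmallDigits hDb.le a) (ofSmallDigits hDb.le a') ^
          ((Real.logb b D).toNNReal : ℝ) := by
    rw [Real.coe_toNNReal _ hr.le, edist_dist, edist_dist,
      ENNReal.ofReal_rpow_of_nonneg dist_nonneg hr.le]
    refine (ENNReal.ofReal_le_ofReal
      (dist_ofDigits_le_mul_dist_ofSmallDigits_rpow (by omega) hDb a a')).trans_eq ?_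
    exact ENNReal.ofReal_mul' (by positivity)
  have hone : 1 ≤ dimH (range (Real.ofDigits (b := D))) := by
    have hIcc : dimH (Icc (0 : ℝ) 1) = 1 :=
      (Real.dimH_of_nonempty_interior (by simp)).trans (by simp)
    have hsurj : Icc (0 : ℝ) 1 ⊆ range (Real.ofDigits (b := D)) :=
      (Real.ofDigits_SurjOn hD).trans (image_subset_range _ _)
    exact hIcc ▸ dimH_mono hsurj
  have hdiv := hone.trans (dimH_range_le_of_edist_le (Real.toNNReal_pos.2 hr) hholder)
  rwa [ENNReal.le_div_iff_mul_le (by simp [hr]) (by simp), one_mul] at hdiv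

lemma ofReal_logb_le_dimH_survivorPiece (hD : 1 < D) (hDb : D < b) :
    ENNReal.ofReal (Real.logb b D) ≤ dimH (survivorPiece b (D / b)) := by
  have hb0 : (b : ℝ)⁻¹ ≠ 0 := inv_ne_zero (Nat.cast_ne_zero.2 (by omega))
  have hscale : (· * (b : ℝ)⁻¹) '' range (ofSmallDigits hDb.le) ⊆ survivorPiece b (D / b) := by
    rintro _ ⟨_, ⟨a, rfl⟩, rfl⟩
    simpa only [mul_comm] using inv_mul_mem_survivorPiece (by omega)
      (ofSmallDigits_mem_Icc hDb.le a) (Real.ofDigits_le_one _)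
      (coe_ofSmallDigits_mem_survivorSet hDb.le a)
  calc ENNReal.ofReal (Real.logb b D) ≤ dimH (range (ofSmallDigits hDb.le)) :=
        ofReal_logb_le_dimH_range_ofSmallDigits hD hDb
    _ = dimH ((· * (b : ℝ)⁻¹) '' range (ofSmallDigits hDb.le)) :=
        ((ContinuousLinearEquiv.unitsEquivAut ℝ (Units.mk0 _ hb0)).dimH_image _).symm
    _ ≤ dimH (survivorPiece b (D / b)) := dimH_mono hscale

lemma ofReal_one_sub_inv_le_dimH_survivorPiece {m : ℕ} (hm : 1 < m) :
    ENNReal.ofReal (1 - (m : ℝ)⁻¹) ≤ dimH (survivorPiece (4 ^ m) (1 / 4)) := by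
  obtain ⟨k, rfl⟩ : ∃ k, m = k + 1 := ⟨m - 1, by omega⟩
  have h := ofReal_logb_le_dimH_survivorPiece (b := 4 ^ (k + 1)) (D := 4 ^ k)
    (Nat.one_lt_pow (by omega) (by norm_num)) (Nat.pow_lt_pow_right (by norm_num) k.lt_succ_self)
  have hratio : ((4 ^ k : ℕ) : ℝ) / (4 ^ (k + 1) : ℕ) = 1 / 4 := by
    push_cast
    field_simp
    ring
  have hlogb : Real.logb (4 ^ (k + 1) : ℕ) (4 ^ k : ℕ) = 1 - ((k + 1 : ℕ) : ℝ)⁻¹ := by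
    have hlog : Real.log 4 ≠ 0 := (Real.log_pos (by norm_num)).ne'
    simp only [Real.logb, Nat.cast_pow, Nat.cast_ofNat, Real.log_pow]
    push_cast
    field_simp
    ring
  rwa [hratio, hlogb] at h

end Digits

section SumsAndProducts

/-- The compact set of dimension one whose sumset is null. Each of the bases `4 ^ 2 ^ (j + 1)` is
the square of the preceding one. -/
def survivorUnion : Set ℝ :=
  ⋃ j : ℕ, survivorPiece (4 ^ 2 ^ (j + 1)) (1 / 4)

lemma isCompact_survivorUnion : IsCompact survivorUnion := by
  have hzero : (0 : ℝ) ∈ survivorUnion :=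
    mem_iUnion.2 ⟨0, zero_mem_survivorPiece _ (by norm_num)⟩
  rw [← insert_eq_of_mem hzero]
  refine isCompact_insert_iUnion_of_tendsto_smallSets (fun j => isCompact_survivorPiece _ _) ?_
  have hbase : Tendsto (fun j : ℕ => (((4 ^ 2 ^ (j + 1) : ℕ) : ℝ))⁻¹) atTop (𝓝 0) := by
    have hexp : Tendsto (fun j : ℕ => 2 ^ (j + 1)) atTop atTop :=
      (tendsto_pow_atTop_atTop_of_one_lt one_lt_two).comp (tendsto_add_atTop_nat 1)
    exact tendsto_inv_atTop_zero.comp <| tendsto_natCast_atTop_atTop.comp <|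
      (tendsto_pow_atTop_atTop_of_one_lt (by norm_num)).comp hexp
  rw [Nat.cofinite_eq_atTop]
  exact (tendsto_const_nhds.Icc hbase).smallSets_mono (.of_forall fun j => inter_subset_left)

lemma dimH_survivorUnion : dimH survivorUnion = 1 := by
  refine le_antisymm ((dimH_mono (subset_univ _)).trans_eq Real.dimH_univ) ?_
  have hinv : Tendsto (fun j : ℕ => ((2 ^ (j + 1) : ℕ) : ℝ)⁻¹) atTop (𝓝 0) :=
    tendsto_inv_atTop_zero.comp <| tendsto_natCast_atTop_atTop.comp <|
      (tendsto_pow_atTop_atTop_of_one_lt one_lt_two).comp (tendsto_add_atTop_nat 1)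
  have hlim : Tendsto (fun j : ℕ => ENNReal.ofReal (1 - ((2 ^ (j + 1) : ℕ) : ℝ)⁻¹)) atTop
      (𝓝 1) := by
    simpa using ENNReal.tendsto_ofReal (hinv.const_sub 1)
  exact le_of_tendsto' hlim fun j =>
    (ofReal_one_sub_inv_le_dimH_survivorPiece (Nat.one_lt_two_pow j.succ_ne_zero)).trans
      (dimH_mono (subset_iUnion (fun j : ℕ => survivorPiece (4 ^ 2 ^ (j + 1)) (1 / 4)) j))

lemma coe_mem_survivorSet_of_mem_survivorPiece {i j : ℕ} (hij : i ≤ j) {c x : ℝ}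
    (hx : x ∈ survivorPiece (4 ^ 2 ^ i) c) :
    (x : UnitAddCircle) ∈ survivorSet (4 ^ 2 ^ j) (initialArc c) := by
  have hpow : 4 ^ 2 ^ j = (4 ^ 2 ^ i) ^ 2 ^ (j - i) := by
    rw [← pow_mul, ← pow_add, Nat.add_sub_cancel' hij]
  exact hpow ▸ survivorSet_subset_survivorSet_pow _ _ _ hx.2

lemma volume_survivorUnion_add_self : volume (survivorUnion + survivorUnion) = 0 := by
  refine measure_mono_null
    (t := ⋃ j : ℕ, (↑) ⁻¹' survivorSet (4 ^ 2 ^ (j + 1)) (initialArc (1 / 4 + 1 / 4))) ?_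
    (measure_iUnion_null fun j => volume_preimage_coe_addCircle_eq_zero
      (volume_survivorSet_eq_zero (Nat.one_lt_pow (by positivity) (by norm_num))
        (isClosed_initialArc _) (initialArc_ne_univ (by norm_num))))
  rintro _ ⟨x, hx, y, hy, rfl⟩
  obtain ⟨i, hi⟩ := mem_iUnion.1 hx
  obtain ⟨j, hj⟩ := mem_iUnion.1 hy
  have hx' := coe_mem_survivorSet_of_mem_survivorPiece (Nat.succ_le_succ (le_max_left i j)) hi
  have hy' := coe_mem_survivorSet_of_mem_survivorPiece (Nat.succ_le_succ (le_max_right i j)) hj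
  exact mem_iUnion.2 ⟨max i j, survivorSet_mono _ (initialArc_add_subset _ _)
    (survivorSet_add_subset _ _ _ (add_mem_add hx' hy'))⟩

lemma exists_isCompact_dimH_eq_one_volume_mul_self_eq_zero :
    ∃ F : Set ℝ, IsCompact F ∧ dimH F = 1 ∧ volume (F * F) = 0 := by
  refine ⟨Real.exp '' survivorUnion, isCompact_survivorUnion.image Real.continuous_exp,
    (dimH_exp_image _).trans dimH_survivorUnion, ?_⟩
  have hmul : Real.exp '' survivorUnion * Real.exp '' survivorUnion =
      Real.exp '' (survivorUnion + survivorUnion) :=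
    (image_image2_distrib Real.exp_add).symm
  rw [hmul]
  exact addHaar_image_eq_zero_of_differentiableOn_of_addHaar_eq_zero volume
    Real.differentiable_exp.differentiableOn volume_survivorUnion_add_self

end SumsAndProducts

section Parabola

lemma inner_parabolaPoint (x y : ℝ) :
    inner ℝ (parabolaPoint x) (parabolaPoint y) = (x * y + 1 / 2) ^ 2 - 1 / 4 := by
  simp only [parabolaPoint, PiLp.inner_apply, Fin.sum_univ_two, Real.inner_apply,
    Matrix.cons_val_zero, Matrix.cons_val_one]
  ring

lemma contDiff_parabolaPoint {n : WithTop ℕ∞} : ContDiff ℝ n parabolaPoint := by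
  rw [contDiff_euclidean]
  intro i
  fin_cases i
  · exact contDiff_id
  · exact contDiff_id.pow 2

lemma dimH_parabolaPoint_image (s : Set ℝ) : dimH (parabolaPoint '' s) = dimH s := by
  refine le_antisymm
    (contDiff_parabolaPoint.contDiffOn.dimH_image_le convex_univ (subset_univ s)) ?_
  have hanti : AntilipschitzWith 1 parabolaPoint := AntilipschitzWith.of_le_mul_dist fun x y => by
    simpa [parabolaPoint, dist_eq_norm] using
      PiLp.norm_apply_le (parabolaPoint x - parabolaPoint y) 0
  exact hanti.le_dimH_image s

lemma dotProductSet_parabolaPoint_image (s : Set ℝ) :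
    dotProductSet (parabolaPoint '' s) = (fun t : ℝ => (t + 1 / 2) ^ 2 - 1 / 4) '' (s * s) := by
  ext t
  simp only [dotProductSet, exists_mem_image, inner_parabolaPoint, ← image2_mul, image_image2,
    mem_image2, eq_comm, Set.mem_ofPred_eq]

lemma volume_dotProductSet_parabolaPoint_image {s : Set ℝ} (hs : volume (s * s) = 0) :
    volume (dotProductSet (parabolaPoint '' s)) = 0 := by
  rw [dotProductSet_parabolaPoint_image]
  have hdiff : Differentiable ℝ fun t : ℝ => (t + 1 / 2) ^ 2 - 1 / 4 := by fun_prop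
  exact addHaar_image_eq_zero_of_differentiableOn_of_addHaar_eq_zero volume
    hdiff.differentiableOn hs

end Parabola

theorem mainTheorem7 :
    (∀ x y : ℝ,
      inner ℝ (parabolaPoint x) (parabolaPoint y) = (x * y + 1 / 2) ^ 2 - 1 / 4) ∧
    ∃ (F : Set ℝ) (E : Set (EuclideanSpace ℝ (Fin 2))),
      (IsCompact F ∧ dimH F = 1 ∧
        volume {t : ℝ | ∃ x ∈ F, ∃ y ∈ F, t = x * y} = 0) ∧
      E = parabolaPoint '' F ∧
      (IsCompact E ∧ E ⊆ standardParabola ∧ dimH E = 1 ∧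
        volume (dotProductSet E) = 0) := by
  obtain ⟨F, hFcompact, hFdim, hFnull⟩ := exists_isCompact_dimH_eq_one_volume_mul_self_eq_zero
  have hmul : {t : ℝ | ∃ x ∈ F, ∃ y ∈ F, t = x * y} = F * F := by
    ext t
    simp only [Set.mem_mul, Set.mem_ofPred_eq, eq_comm]
  exact ⟨inner_parabolaPoint, F, parabolaPoint '' F, ⟨hFcompact, hFdim, hmul ▸ hFnull⟩, rfl,
    hFcompact.image (contDiff_parabolaPoint (n := 0)).continuous, image_subset_range _ _,
    (dimH_parabolaPoint_image F).trans hFdim, volume_dotProductSet_parabolaPoint_image hFnull⟩
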